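/- Let $R$ be an associative ring with unity (not necessarily commutative). Call $R$ \emph{local} if $R\neq 0$ and, for all $a,b\in R$ with $a+b=1$, at least one of $a,b$ is a unit (equivalently, $R$ has a unique maximal left ideal). Call $R$ \emph{right hypercyclic} if every cyclic right $R$-module has a cyclic injective hull. Call $R$ \emph{left maximal} if, for every family $\{I_\alpha\}_{\alpha\in\Lambda}$ of left ideals of $R$ and every family $\{x_\alpha\}_{\alpha\in\Lambda}$ of elements of $R$ such that the congruences $$x\equiv x_\alpha \pmod{I_\alpha}\qquad(\alpha\in\Lambda)$$ are pairwise solvable (for all $\alpha,\beta\in\Lambda$ there is $x\in R$ with $x-x_\alpha\in I_\alpha$ and $x-x_\beta\in I_\beta$), there is an element $x\in R$ with $x-x_\alpha\in I_\alpha$ for all $\alpha\in\Lambda$. \textbf{Theorem.} Every local right hypercyclic ring is left maximal. -/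

import Mathlib

universe u v w

/-- A module is cyclic if it is generated by a single element. -/
def IsCyclicMod (S : Type u) [Ring S] (M : Type v) [AddCommGroup M] [Module S M] : Prop :=
  ∃ m : M, Submodule.span S {m} = ⊤

/-- A submodule `N` of `M` is essential if it meets every nonzero submodule of `M` nontrivially. -/
def IsEssentialSubmodule {S : Type u} [Ring S] {M : Type v} [AddCommGroup M] [Module S M]
    (N : Submodule S M) : Prop :=
  ∀ K : Submodule S M, N ⊓ K = ⊥ → K = ⊥

/-- The map `i : M → E` makes `E` an injective hull of `M`: `E` is an injective module, and `i` is
an embedding with essential image. All modules live in the universe of the ring, where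
`Module.Injective` is the usual (universe-independent) notion, by Baer's criterion. -/
structure IsInjectiveHull {S : Type u} [Ring S] {M E : Type u} [AddCommGroup M] [Module S M]
    [AddCommGroup E] [Module S E] (i : M →ₗ[S] E) : Prop where
  injective_module : Module.Injective S E
  injective_map : Function.Injective i
  essential_range : IsEssentialSubmodule (LinearMap.range i)

/-- A ring `R` is right hypercyclic if every cyclic right `R`-module has a cyclic injective hull.
Right `R`-modules are modules over the opposite ring `Rᵐᵒᵖ`. Injective hulls are unique up to
isomorphism, so it does not matter which one is taken. -/
def IsRightHypercyclic (R : Type u) [Ring R] : Prop :=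
  ∀ (M : Type u) [AddCommGroup M] [Module Rᵐᵒᵖ M], IsCyclicMod Rᵐᵒᵖ M →
    ∃ (E : Type u) (_ : AddCommGroup E) (_ : Module Rᵐᵒᵖ E) (i : M →ₗ[Rᵐᵒᵖ] E),
      IsInjectiveHull i ∧ IsCyclicMod Rᵐᵒᵖ E

/-- A ring `R` is left maximal if every family of congruences `x ≡ a α (mod I α)` modulo left
ideals `I α`, any two of which have a common solution, has a simultaneous solution.
(`Ideal R` is the type of left ideals of `R`.) -/
def IsLeftMaximal (R : Type u) [Ring R] : Prop :=
  ∀ (Λ : Type w) (I : Λ → Ideal R) (a : Λ → R),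
    (∀ α β : Λ, ∃ x : R, x - a α ∈ I α ∧ x - a β ∈ I β) →
    ∃ x : R, ∀ α : Λ, x - a α ∈ I α

/-!
The argument has two halves, the first about right `R`-modules, written below as left modules over
`S = Rᵐᵒᵖ`.

*A local ring all of whose cyclic left modules have cyclic injective hulls is a self-injective
chain ring.* Let `E = S x` be cyclic and injective and let `0 ≠ N ≤ E` be cyclic. The cyclic
injective hull of `N` embeds in `E` as a direct summand, so it is the range of an idempotent
endomorphism `p` of `E`. If `p x = r x`, then `r` or `1 - r` is a unit, so `p` or `1 - p` is
surjective; as `N ≠ 0`, it is `p`, and `N` is essential in `E` (`isEssential_of_cyclic_injective`).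
Applied to the hull of `S ⧸ (A ⊓ B)` this makes any two left ideals `A`, `B` of `S` comparable
(`IsLeftHypercyclic.ideal_total`). The hull `S x` of `S` itself is then free: if `1` corresponds to
`r x`, the annihilator of `x` meets `S r` trivially, hence it vanishes (`IsLeftHypercyclic.baer`).

*Congruences.* Over a left self-injective ring `S`, principal right ideals are annihilators:
`c ∈ b S` as soon as every `s` with `s b = 0` satisfies `s c = 0`
(`exists_eq_mul_of_annihilator_le`). Hence the right ideals of a self-injective left chain ring form
a chain as well. A pairwise solvable family of congruences `x ≡ y α (mod b α S)` gives compatible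
maps `s ↦ s y α` on the left annihilators of the `b α`; they glue along the chain of annihilators,
and an extension of the result to `S` is right multiplication by a common solution
(`exists_simultaneous_solution_principal`). For arbitrary left ideals `I α` of `R`, either some
`I α` is the smallest one, and `a α` is a solution, or every `I α` contains a principal left ideal
which in turn contains another `I β`, and the principal case applies.
-/

/-! ### Local rings whose cyclic modules have cyclic injective hulls -/

/-- Every cyclic left `S`-module has a cyclic injective hull. For `S = Rᵐᵒᵖ` this unfolds to
`IsRightHypercyclic R`. -/
def IsLeftHypercyclic (S : Type u) [Ring S] : Prop :=
  ∀ (M : Type u) [AddCommGroup M] [Module S M], IsCyclicMod S M →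
    ∃ (E : Type u) (_ : AddCommGroup E) (_ : Module S E) (i : M →ₗ[S] E),
      IsInjectiveHull i ∧ IsCyclicMod S E

theorem IsCyclicMod.exists_smul_eq {S : Type u} [Ring S] {M : Type v} [AddCommGroup M]
    [Module S M] (h : IsCyclicMod S M) : ∃ m : M, ∀ z : M, ∃ s : S, s • m = z := by
  obtain ⟨m, hm⟩ := h
  exact ⟨m, fun z => Submodule.mem_span_singleton.1 (hm ▸ Submodule.mem_top)⟩

/-- An endomorphism of `S x` that maps `x` to a unit multiple of `x` is surjective. -/
theorem surjective_of_apply_eq_isUnit_smul {S : Type u} [Ring S] {E : Type v} [AddCommGroup E]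
    [Module S E] {x : E} (hx : ∀ z : E, ∃ s : S, s • x = z) (p : E →ₗ[S] E) {r : S}
    (hr : IsUnit r) (hp : p x = r • x) : Function.Surjective p := by
  intro z
  obtain ⟨s, rfl⟩ := hx z
  obtain ⟨t, rfl⟩ := hr
  exact ⟨(s * (↑t⁻¹ : S)) • x, by rw [map_smul, hp, smul_smul, mul_assoc, Units.inv_mul, mul_one]⟩

theorem isEssential_of_cyclic_injective {S : Type u} [Ring S] [IsLocalRing S]
    (hS : IsLeftHypercyclic S) {E : Type u} [AddCommGroup E] [Module S E]
    (hE : Module.Injective S E) (hc : IsCyclicMod S E) (e : E) (he : e ≠ 0) :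
    IsEssentialSubmodule (Submodule.span S {e}) := by
  intro K hK
  obtain ⟨x, hx⟩ := hc.exists_smul_eq
  have hcyc : IsCyclicMod S (Submodule.span S {e}) := by
    refine ⟨⟨e, Submodule.mem_span_singleton_self e⟩, ?_⟩
    rw [eq_top_iff]
    rintro ⟨z, hz⟩ -
    obtain ⟨s, rfl⟩ := Submodule.mem_span_singleton.1 hz
    exact Submodule.mem_span_singleton.2 ⟨s, rfl⟩
  obtain ⟨F, _, _, i, hi, -⟩ := hS _ hcyc
  obtain ⟨h, hh⟩ := hE.out i hi.injective_map (Submodule.span S {e}).subtype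
  -- The kernel of `h` misses the essential submodule `range i`.
  have hker : LinearMap.ker h = ⊥ := by
    refine hi.essential_range _ ?_
    rw [eq_bot_iff]
    rintro _ ⟨⟨n, rfl⟩, hn⟩
    have : n = 0 := by
      apply Subtype.ext
      rw [← Submodule.subtype_apply, ← hh]
      exact hn
    simp [this]
  have hinj : Function.Injective h := LinearMap.ker_eq_bot.1 hker
  obtain ⟨π, hπ⟩ := hi.injective_module.out h hinj LinearMap.id
  obtain ⟨r, hr⟩ := hx (h (π x))
  rcases IsLocalRing.isUnit_or_isUnit_of_add_one (add_sub_cancel r 1) with hu | hu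
  · have hsurj : Function.Surjective (h ∘ₗ π) :=
      surjective_of_apply_eq_isUnit_smul hx _ hu hr.symm
    rw [eq_bot_iff]
    intro k hk
    -- Now `h` is bijective, so that `K` can be pulled back to the hull of `S e`.
    have hcomap : K.comap h = ⊥ := by
      refine hi.essential_range _ ?_
      rw [eq_bot_iff]
      rintro _ ⟨⟨n, rfl⟩, hn⟩
      have h0 : (n : E) ∈ Submodule.span S {e} ⊓ K := by
        refine ⟨n.2, ?_⟩
        have := hh n
        rw [Submodule.subtype_apply] at this
        rw [← this]
        exact hn
      rw [hK, Submodule.mem_bot] at h0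
      have : n = 0 := Subtype.ext h0
      simp [this]
    obtain ⟨w, rfl⟩ := hsurj k
    have hw : π w ∈ K.comap h := hk
    rw [hcomap, Submodule.mem_bot] at hw
    simp [hw]
  · exfalso
    have hsurj : Function.Surjective (LinearMap.id - h ∘ₗ π : E →ₗ[S] E) :=
      surjective_of_apply_eq_isUnit_smul hx _ hu (by
        simp [sub_smul, hr])
    -- `π` vanishes on the range of `1 - h π`, which contains `e`.
    have hπ0 : ∀ z, π z = 0 := by
      intro z
      obtain ⟨w, rfl⟩ := hsurj z
      simp [hπ]
    have h1 := hπ (i ⟨e, Submodule.mem_span_singleton_self e⟩)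
    rw [hπ0, LinearMap.id_apply] at h1
    have h2 := hh ⟨e, Submodule.mem_span_singleton_self e⟩
    rw [← h1, map_zero] at h2
    exact he h2.symm

theorem isCyclicMod_quotient {S : Type u} [Ring S] (I : Ideal S) : IsCyclicMod S (S ⧸ I) := by
  refine ⟨Submodule.Quotient.mk 1, ?_⟩
  rw [eq_top_iff]
  intro z _
  obtain ⟨s, rfl⟩ := Submodule.Quotient.mk_surjective I z
  exact Submodule.mem_span_singleton.2 ⟨s, by
    rw [← Submodule.Quotient.mk_smul, smul_eq_mul, mul_one]⟩

theorem IsLeftHypercyclic.ideal_total {S : Type u} [Ring S] [IsLocalRing S]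
    (hS : IsLeftHypercyclic S) (A B : Ideal S) : A ≤ B ∨ B ≤ A := by
  by_contra! hcon
  obtain ⟨hAB, hBA⟩ := hcon
  obtain ⟨a, haA, haB⟩ := SetLike.not_le_iff_exists.1 hAB
  obtain ⟨b, hbB, hbA⟩ := SetLike.not_le_iff_exists.1 hBA
  obtain ⟨E, _, _, i, hi, hE⟩ := hS (S ⧸ (A ⊓ B)) (isCyclicMod_quotient _)
  have hzero : ∀ s : S, i (Submodule.Quotient.mk s) = 0 ↔ s ∈ A ⊓ B := fun s => by
    rw [map_eq_zero_iff i hi.injective_map, Submodule.Quotient.mk_eq_zero]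
  have ha : i (Submodule.Quotient.mk a) ≠ 0 := fun h => haB ((hzero a).1 h).2
  have hb : i (Submodule.Quotient.mk b) ≠ 0 := fun h => hbA ((hzero b).1 h).1
  have := isEssential_of_cyclic_injective hS hi.injective_module hE _ ha
    (Submodule.span S {i (Submodule.Quotient.mk b)}) (by
      rw [eq_bot_iff]
      rintro z ⟨hz1, hz2⟩
      obtain ⟨s, rfl⟩ := Submodule.mem_span_singleton.1 hz1
      obtain ⟨t, ht⟩ := Submodule.mem_span_singleton.1 hz2
      rw [← map_smul, ← map_smul, ← Submodule.Quotient.mk_smul, ← Submodule.Quotient.mk_smul]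
        at ht
      have hmem := (Submodule.Quotient.eq _).1 (hi.injective_map ht)
      rw [Submodule.mem_bot, ← map_smul, ← Submodule.Quotient.mk_smul, hzero]
      refine ⟨A.smul_mem s haA, ?_⟩
      have := B.sub_mem (B.smul_mem t hbB) hmem.2
      rwa [sub_sub_cancel] at this)
  exact hb (Submodule.span_singleton_eq_bot.1 this)

/-- A local ring whose cyclic left modules have cyclic injective hulls is left self-injective. -/
theorem IsLeftHypercyclic.baer {S : Type u} [Ring S] [IsLocalRing S]
    (hS : IsLeftHypercyclic S) : Module.Baer S S := by
  obtain ⟨E, _, _, i, hi, hE⟩ := hS S ⟨1, Ideal.span_singleton_one⟩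
  obtain ⟨x, hx⟩ := hE.exists_smul_eq
  obtain ⟨r, hr⟩ := hx (i 1)
  have hsmul : ∀ s : S, s • r • x = i s := fun s => by
    rw [hr, ← map_smul, smul_eq_mul, mul_one]
  have hann : LinearMap.ker (LinearMap.toSpanSingleton S E x) = ⊥ := by
    rcases hS.ideal_total (LinearMap.ker (LinearMap.toSpanSingleton S E x)) (Ideal.span {r})
      with h | h
    · rw [eq_bot_iff]
      intro k hk
      obtain ⟨s, rfl⟩ := Ideal.mem_span_singleton'.1 (h hk)
      rw [LinearMap.mem_ker, LinearMap.toSpanSingleton_apply, mul_smul, hsmul,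
        map_eq_zero_iff i hi.injective_map] at hk
      simp [hk]
    · exfalso
      have hk := h (Ideal.mem_span_singleton_self r)
      rw [LinearMap.mem_ker, LinearMap.toSpanSingleton_apply, hr,
        map_eq_zero_iff i hi.injective_map] at hk
      exact one_ne_zero hk
  have e : S ≃ₗ[S] E := LinearEquiv.ofBijective (LinearMap.toSpanSingleton S E x)
    ⟨LinearMap.ker_eq_bot.1 hann, hx⟩
  exact (Module.Baer.of_injective hi.injective_module).of_equiv e.symm

/-! ### Congruences modulo principal right ideals of a self-injective chain ring -/

/-- In a left self-injective ring, a principal right ideal `b S` contains every `c` killed by the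
left annihilator of `b`. -/
theorem exists_eq_mul_of_annihilator_le {S : Type u} [Ring S] (hS : Module.Baer S S) {b c : S}
    (h : ∀ s : S, s * b = 0 → s * c = 0) : ∃ d : S, c = b * d := by
  -- The map `s b ↦ s c`, extended to `S`, is right multiplication by the required element.
  let L := LinearMap.toSpanSingleton S S b
  have hker : LinearMap.ker L ≤ LinearMap.ker (LinearMap.toSpanSingleton S S c) :=
    fun s hs => h s hs
  obtain ⟨g, hg⟩ := hS.extension_property ((LinearMap.ker L).liftQ L le_rfl)
    (LinearMap.ker_eq_bot.1 (Submodule.ker_liftQ_eq_bot _ _ _ le_rfl))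
    ((LinearMap.ker L).liftQ (LinearMap.toSpanSingleton S S c) hker)
  refine ⟨g 1, ?_⟩
  have hgb : g b = c := by
    have h1 := LinearMap.congr_fun hg (Submodule.Quotient.mk 1)
    rw [LinearMap.comp_apply, Submodule.liftQ_apply, Submodule.liftQ_apply,
      LinearMap.toSpanSingleton_apply, LinearMap.toSpanSingleton_apply, one_smul, one_smul] at h1
    exact h1
  rw [← hgb, ← smul_eq_mul, ← map_smul, smul_eq_mul, mul_one]

/-- The right ideals of a left self-injective left chain ring form a chain. -/
theorem exists_eq_mul_or_exists_eq_mul {S : Type u} [Ring S] (hS : Module.Baer S S)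
    (htot : ∀ A B : Ideal S, A ≤ B ∨ B ≤ A) (b c : S) :
    (∃ d : S, c = b * d) ∨ ∃ d : S, b = c * d :=
  (htot (LinearMap.ker (LinearMap.toSpanSingleton S S b))
    (LinearMap.ker (LinearMap.toSpanSingleton S S c))).imp
    (fun h => exists_eq_mul_of_annihilator_le hS fun _ hs => h hs)
    (fun h => exists_eq_mul_of_annihilator_le hS fun _ hs => h hs)

theorem exists_simultaneous_solution_principal {S : Type u} [Ring S] (hS : Module.Baer S S)
    (htot : ∀ A B : Ideal S, A ≤ B ∨ B ≤ A) {Λ : Type w} (b y : Λ → S)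
    (hy : ∀ α β : Λ, ∃ c d : S, y α - y β = b α * c + b β * d) :
    ∃ x : S, ∀ α : Λ, ∃ d : S, x - y α = b α * d := by
  rcases isEmpty_or_nonempty Λ with _ | _
  · exact ⟨0, fun α => isEmptyElim α⟩
  have hwd : ∀ (α β : Λ) (s : S), s * b α = 0 → s * b β = 0 → s * y α = s * y β := by
    intro α β s hα hβ
    obtain ⟨c, d, hcd⟩ := hy α β
    rw [← sub_eq_zero, ← mul_sub, hcd, mul_add, ← mul_assoc, ← mul_assoc, hα, hβ, zero_mul,
      zero_mul, add_zero]
  let A : Λ → Ideal S := fun α => LinearMap.ker (LinearMap.toSpanSingleton S S (b α))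
  have hdir : Directed (· ≤ ·) A := fun α β =>
    (htot (A α) (A β)).elim (fun h => ⟨β, h, le_rfl⟩) (fun h => ⟨α, le_rfl, h⟩)
  have hmem : ∀ s : ↥(⨆ α, A α), ∃ α, (s : S) * b α = 0 := fun s =>
    (Submodule.mem_iSup_of_directed A hdir).1 s.2
  choose ι hι using hmem
  have hf : ∀ (s : ↥(⨆ α, A α)) (α : Λ), (s : S) * b α = 0 → (s : S) * y (ι s) = s * y α :=
    fun s α h => hwd _ _ _ (hι s) h
  let f : ↥(⨆ α, A α) →ₗ[S] S :=
    { toFun := fun s => (s : S) * y (ι s)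
      map_add' := by
        intro s t
        obtain ⟨γ, hsγ, htγ⟩ := hdir (ι s) (ι t)
        have hs : (s : S) * b γ = 0 := hsγ (hι s)
        have ht : (t : S) * b γ = 0 := htγ (hι t)
        rw [hf s γ hs, hf t γ ht, hf (s + t) γ (by
          rw [Submodule.coe_add, add_mul, hs, ht, add_zero]), Submodule.coe_add, add_mul]
      map_smul' := by
        intro r s
        rw [hf (r • s) (ι s) (by
          rw [Submodule.coe_smul, smul_eq_mul, mul_assoc, hι, mul_zero]), Submodule.coe_smul,
          RingHom.id_apply, smul_eq_mul, smul_eq_mul, mul_assoc] }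
  obtain ⟨g, hg⟩ := hS _ f
  refine ⟨g 1, fun α => exists_eq_mul_of_annihilator_le hS fun s hs => ?_⟩
  have hsA : s ∈ ⨆ α, A α := Submodule.mem_iSup_of_mem α hs
  have h1 : g s = s * y α := (hg s hsA).trans (hf ⟨s, hsA⟩ α hs)
  have h2 : g s = s * g 1 := by rw [← smul_eq_mul, ← map_smul, smul_eq_mul, mul_one]
  rw [mul_sub, ← h1, ← h2, sub_self]

/-! ### Congruences modulo arbitrary left ideals -/

open MulOpposite in
theorem mainTheorem12 (R : Type u) [Ring R] [IsLocalRing R] (hR : IsRightHypercyclic R) :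
    IsLeftMaximal.{u, w} R := by
  have : IsLocalRing Rᵐᵒᵖ :=
    { isUnit_or_isUnit_of_add_one := fun {a b} h =>
        (IsLocalRing.isUnit_or_isUnit_of_add_one (congrArg unop h)).imp
          (fun h => isUnit_unop.1 h) (fun h => isUnit_unop.1 h) }
  have hS : IsLeftHypercyclic Rᵐᵒᵖ := hR
  have hbaer := hS.baer
  intro Λ I a ha
  have hdiff : ∀ α β, ∃ u ∈ I α, ∃ v ∈ I β, a α - a β = u + v := fun α β => by
    obtain ⟨x, h1, h2⟩ := ha α β
    exact ⟨a α - x, by rw [← neg_sub]; exact (I α).neg_mem h1, x - a β, h2, by abel⟩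
  by_cases hmin : ∃ α, ∀ β, I α ≤ I β
  · obtain ⟨α, hα⟩ := hmin
    refine ⟨a α, fun β => ?_⟩
    obtain ⟨u, hu, v, hv, h⟩ := hdiff α β
    rw [h]
    exact (I β).add_mem (hα β hu) hv
  · push Not at hmin
    choose β hβ using hmin
    choose b hb hb' using fun α => SetLike.not_le_iff_exists.1 (hβ α)
    -- Left ideals of `R` form a chain and `b α` lies outside `I (β α)`, so `I (β α) ≤ R b α`.
    have hle : ∀ α, ∀ c ∈ I (β α), ∃ d, op c = op (b α) * d := fun α c hc => by
      rcases exists_eq_mul_or_exists_eq_mul hbaer hS.ideal_total (op (b α)) (op c) with h | ⟨d, hd⟩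
      · exact h
      · refine absurd ?_ (hb' α)
        rw [← unop_op (b α), hd, unop_mul, unop_op]
        exact (I (β α)).mul_mem_left _ hc
    obtain ⟨x, hx⟩ := exists_simultaneous_solution_principal hbaer hS.ideal_total
      (fun α => op (b α)) (fun α => op (a (β α))) (fun α γ => by
        obtain ⟨u, hu, v, hv, h⟩ := hdiff (β α) (β γ)
        obtain ⟨c, hc⟩ := hle α u hu
        obtain ⟨d, hd⟩ := hle γ v hv
        exact ⟨c, d, by rw [← op_sub, h, op_add, hc, hd]⟩)
    refine ⟨unop x, fun α => ?_⟩
    obtain ⟨d, hd⟩ := hx α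
    have h1 : unop x - a (β α) ∈ I α := by
      have : unop x - a (β α) = unop d * b α := by
        rw [← unop_op (a (β α)), ← unop_sub, hd, unop_mul, unop_op]
      rw [this]
      exact (I α).mul_mem_left _ (hb α)
    -- `β α` and `α` have congruent right-hand sides modulo `I α`, since `I (β α) ≤ R b α ≤ I α`.
    obtain ⟨u, hu, v, hv, h⟩ := hdiff (β α) α
    obtain ⟨c, hc⟩ := hle α u hu
    have hu' : u ∈ I α := by
      rw [← unop_op u, hc, unop_mul, unop_op]
      exact (I α).mul_mem_left _ (hb α)
    rw [← sub_add_sub_cancel _ (a (β α)), h]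
    exact (I α).add_mem h1 ((I α).add_mem hu' hv)
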